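/- For integers $m\ge 1$ and $0\le r\le m$, let $\mathrm{RM}(r,m)\subseteq\mathbb F_2^{2^m}$ be the binary Reed-Muller code of order $r$, defined recursively: $\mathrm{RM}(0,m)=\{\overline 0,\overline 1\}$, $\mathrm{RM}(m,m)=\mathbb F_2^{2^m}$, and for $1\le r\le m-1$, $\mathrm{RM}(r,m)=\{(u,u+v) : u\in \mathrm{RM}(r,m-1),\ v\in \mathrm{RM}(r-1,m-1)\}$. For an integer $t\ge 1$, let $R_t(r,m)$ denote the $t$-th generalized covering radius of $\mathrm{RM}(r,m)$: the least integer $\rho\ge 0$ such that for every matrix $\mathbf v\in\mathbb F_2^{t\times 2^m}$ there is a matrix $\mathbf c\in\mathbb F_2^{t\times 2^m}$, all of whose rows belong to $\mathrm{RM}(r,m)$, such that $\mathbf v-\mathbf c$ has at most $\rho$ nonzero columns. Theorem. Let $t\ge 1$ be an integer and let $\alpha$ be a real number with $0<\alpha<1-\frac{1}{\sqrt2}$, both constant. Then, as $m\to\infty$ over the positive integers $m$ for which $\alpha m$ is an integer, $$R_t(\alpha m,m)\;\le\;\Bigl(1-\frac1{2^t}\Bigr)2^m-\frac{\sqrt{2^t-1}}{2^t(2+\sqrt2)}\,2^{m\left(\frac12+\alpha\log_2(1+\sqrt2)\right)}\,(1+o(1)).$$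 That is, there is a real sequence $(\varepsilon_m)$ with $\varepsilon_m\to 0$, depending only on $t$ and $\alpha$, such that for every positive integer $m$ with $\alpha m\in\mathbb N$ the inequality holds with $1+\varepsilon_m$ in place of $1+o(1)$. -/

import Mathlib

open Filter Topology

namespace GenCov

/-- The `t`-weight of a `t × n` matrix: the number of coordinates in the union of the supports
of its rows. -/
noncomputable def tWeight {F : Type*} [Field F] {t n : ℕ} (v : Matrix (Fin t) (Fin n) F) : ℕ :=
  (⋃ i : Fin t, Function.support (v i)).ncard

/-- The metric on `t × n` matrices induced by the `t`-weight. -/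
noncomputable def tDist {F : Type*} [Field F] {t n : ℕ} (v u : Matrix (Fin t) (Fin n) F) : ℕ :=
  tWeight (v - u)

/-- The ball of radius `r` centered at `v` for the metric `tDist`. -/
def tBall {F : Type*} [Field F] {t n : ℕ} (r : ℕ) (v : Matrix (Fin t) (Fin n) F) :
    Set (Matrix (Fin t) (Fin n) F) :=
  {v' | tDist v v' ≤ r}

/-- `C^t`: the `t × n` matrices all of whose rows are codewords of `C`. -/
def codePow {F : Type*} [Field F] {n : ℕ} (C : Submodule F (Fin n → F)) (t : ℕ) :
    Set (Matrix (Fin t) (Fin n) F) :=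
  {c | ∀ i : Fin t, c i ∈ C}

/-- The `t`-th generalized covering radius of a linear code `C` of length `n`: the least `r` for
which the balls of radius `r` centered at the elements of `C^t` cover all `t × n` matrices.
(Such `r` exist, as `r = n` always qualifies.) -/
noncomputable def genCoveringRadius {F : Type*} [Field F] {n : ℕ}
    (t : ℕ) (C : Submodule F (Fin n → F)) : ℕ :=
  sInf {r : ℕ | ⋃ c ∈ codePow C t, tBall r c = Set.univ}

/-- The `(u, u+v)` construction. -/
def uuvCode {F : Type*} [Field F] {n : ℕ} (C₁ C₂ : Submodule F (Fin n → F)) :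
    Submodule F (Fin (n + n) → F) where
  carrier := {w | ∃ u ∈ C₁, ∃ v ∈ C₂, w = Fin.append u (u + v)}
  zero_mem' := by
    refine ⟨0, C₁.zero_mem, 0, C₂.zero_mem, ?_⟩
    ext j
    refine Fin.addCases (fun i => ?_) (fun i => ?_) j
    · simp
    · simp only [Pi.zero_apply, Fin.append_right, add_zero]
  add_mem' := by
    rintro _ _ ⟨u, hu, v, hv, rfl⟩ ⟨u', hu', v', hv', rfl⟩
    refine ⟨u + u', C₁.add_mem hu hu', v + v', C₂.add_mem hv hv', ?_⟩
    ext j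
    refine Fin.addCases (fun i => ?_) (fun i => ?_) j
    · simp
    · simp only [Pi.add_apply, Fin.append_right]
      ring
  smul_mem' := by
    rintro a _ ⟨u, hu, v, hv, rfl⟩
    refine ⟨a • u, C₁.smul_mem a hu, a • v, C₂.smul_mem a hv, ?_⟩
    ext j
    refine Fin.addCases (fun i => ?_) (fun i => ?_) j
    · simp
    · simp only [Pi.smul_apply, Pi.add_apply, Fin.append_right, smul_eq_mul]
      ring

theorem two_pow_add_two_pow (m : ℕ) : 2 ^ m + 2 ^ m = 2 ^ (m + 1) := by
  rw [pow_succ, mul_two]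

/-- The binary Reed-Muller code `RM(r, m)` of order `r` and length `2 ^ m`, by recursion:
`RM(0, m)` is the repetition code `{0, 1}`, `RM(m, m)` is the whole space, and for
`1 ≤ r ≤ m - 1` the code `RM(r, m)` is obtained by the `(u, u+v)` construction from
`RM(r, m - 1)` and `RM(r - 1, m - 1)`, with the two halves of a word of length
`2 ^ (m - 1) + 2 ^ (m - 1)` read as a word of length `2 ^ m`.
(For `r > m`, which is not used, the value is the whole space.) -/
def reedMuller : (r m : ℕ) → Submodule (ZMod 2) (Fin (2 ^ m) → ZMod 2)
  | _, 0 => ⊤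
  | 0, _ + 1 => Submodule.span (ZMod 2) {1}
  | r + 1, m + 1 =>
    if m ≤ r then ⊤
    else (uuvCode (reedMuller (r + 1) m) (reedMuller r m)).comap
      (LinearMap.funLeft (ZMod 2) (ZMod 2) (Fin.cast (two_pow_add_two_pow m)))

/-- `R_t(r, m)`, the `t`-th generalized covering radius of `RM(r, m)`. -/
noncomputable def rmCoveringRadius (t r m : ℕ) : ℕ :=
  genCoveringRadius t (reedMuller r m)

end GenCov

/-! The `(u, u + v)` construction gives R(r+1, m+1) ≤ R(r+1, m) + R(r, m), so it suffices to bound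
the edges r = 1 and r = m and compare with explicit solutions of the recursion.

For r = 1 (`genCoveringRadius_le_of_separating`), the number of columns in which a uniformly random
tuple of codewords agrees with `v` has mean n/2^t. Its deviation has the second moment of a sum of
independent indicators and nonnegative third moment, so some tuple exceeds the mean by a full
standard deviation.

The resulting gain of order √2^m propagates as (1+√2)^(r-1) √2^m. On r = m, where R = 0, this may be
too large, so `rmCoveringRadius_succ_le` subtracts another solution, a^r (1+1/a)^m. For r = αm and a
suitable `a` (`exists_parameter`), that correction is exponentially smaller than the gain exactly
because α < 1 - 1/√2 = 1/(2+√2). -/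

namespace GenCov

/-! ### Generalized covering radii and the `(u, u + v)` construction -/

section CoveringRadius

variable {F : Type*} [Field F] {n : ℕ}

theorem mem_genCoveringRadius_set_iff {t r : ℕ} {C : Submodule F (Fin n → F)} :
    (⋃ c ∈ codePow C t, tBall r c = Set.univ) ↔
      ∀ v : Matrix (Fin t) (Fin n) F, ∃ c ∈ codePow C t, tDist c v ≤ r := by
  simp [Set.eq_univ_iff_forall, tBall]

theorem tWeight_le {t : ℕ} (v : Matrix (Fin t) (Fin n) F) : tWeight v ≤ n := by
  have h := Set.ncard_le_ncard (Set.subset_univ (⋃ i : Fin t, Function.support (v i)))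
  rw [Set.ncard_univ, Nat.card_eq_fintype_card, Fintype.card_fin] at h
  exact h

theorem exists_tDist_le_genCoveringRadius {t : ℕ} (C : Submodule F (Fin n → F))
    (v : Matrix (Fin t) (Fin n) F) : ∃ c ∈ codePow C t, tDist c v ≤ genCoveringRadius t C := by
  have hne : {r : ℕ | ⋃ c ∈ codePow C t, tBall r c = Set.univ}.Nonempty :=
    ⟨n, mem_genCoveringRadius_set_iff.2 fun v => ⟨0, fun _ => C.zero_mem, tWeight_le _⟩⟩
  exact mem_genCoveringRadius_set_iff.1 (Nat.sInf_mem hne) v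

theorem genCoveringRadius_le {t r : ℕ} {C : Submodule F (Fin n → F)}
    (h : ∀ v : Matrix (Fin t) (Fin n) F, ∃ c ∈ codePow C t, tDist c v ≤ r) :
    genCoveringRadius t C ≤ r :=
  Nat.sInf_le (mem_genCoveringRadius_set_iff.2 h)

theorem genCoveringRadius_le_real {t : ℕ} {C : Submodule F (Fin n → F)} {B : ℝ}
    (h : ∀ v : Matrix (Fin t) (Fin n) F, ∃ c ∈ codePow C t, (tDist c v : ℝ) ≤ B) :
    (genCoveringRadius t C : ℝ) ≤ B := by
  obtain ⟨c, -, hc⟩ := h 0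
  have hB : 0 ≤ B := (Nat.cast_nonneg _).trans hc
  refine (Nat.le_floor_iff hB).1 (genCoveringRadius_le fun v => ?_)
  obtain ⟨c, hcC, hc⟩ := h v
  exact ⟨c, hcC, Nat.le_floor hc⟩

open Classical in
theorem tWeight_eq_card {t : ℕ} (v : Matrix (Fin t) (Fin n) F) :
    tWeight v = (Finset.univ.filter fun j => ∃ i, v i j ≠ 0).card := by
  rw [tWeight, ← Set.ncard_coe_finset]
  congr 1
  ext j
  simp

theorem genCoveringRadius_top (t : ℕ) :
    genCoveringRadius t (⊤ : Submodule F (Fin n → F)) = 0 :=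
  Nat.le_zero.1 <| genCoveringRadius_le fun v =>
    ⟨v, fun _ => Submodule.mem_top, by simp [tDist, tWeight_eq_card]⟩

open Classical in
theorem tWeight_append_halves {t n' N : ℕ} (e : n + n' = N) (v : Matrix (Fin t) (Fin N) F) :
    tWeight v = tWeight (.of fun i j => v i (Fin.cast e (Fin.castAdd n' j)))
      + tWeight (.of fun i j => v i (Fin.cast e (Fin.natAdd n j))) := by
  subst e
  rw [tWeight_eq_card, tWeight_eq_card, tWeight_eq_card, Finset.card_filter, Finset.card_filter,
    Finset.card_filter, Fin.sum_univ_add]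
  rfl

/-- The generalized covering radius of a `(u, u + v)` code is at most the sum of the generalized
covering radii of its two constituents. -/
theorem genCoveringRadius_uuvCode_le (t : ℕ) {N : ℕ} (e : n + n = N)
    (C₁ C₂ : Submodule F (Fin n → F)) :
    genCoveringRadius t ((uuvCode C₁ C₂).comap (LinearMap.funLeft F F (Fin.cast e))) ≤
      genCoveringRadius t C₁ + genCoveringRadius t C₂ := by
  subst e
  refine genCoveringRadius_le fun w => ?_
  obtain ⟨u, hu, hud⟩ := exists_tDist_le_genCoveringRadius C₁
    (Matrix.of fun i j => w i (Fin.castAdd n j))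
  -- The right half is approximated only after subtracting the `u` already chosen for the left half.
  obtain ⟨v, hv, hvd⟩ := exists_tDist_le_genCoveringRadius C₂
    (Matrix.of fun i j => w i (Fin.natAdd n j) - u i j)
  refine ⟨.of fun i => Fin.append (u i) (u i + v i), fun i => ?_, ?_⟩
  · exact ⟨u i, hu i, v i, hv i, by ext j; simp [LinearMap.funLeft]⟩
  · refine le_trans (le_of_eq ?_) (add_le_add hud hvd)
    refine (tWeight_append_halves rfl _).trans (congrArg₂ _ (congrArg _ ?_) (congrArg _ ?_))
    · ext i j
      simp
    · ext i j
      simp only [Matrix.sub_apply, Matrix.of_apply, Fin.cast_eq_self, Fin.append_right, Pi.add_apply]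
      ring

end CoveringRadius

/-! ### A three-moment inequality and sums of orthogonal variables -/

section Moments

/-- A real function on a nonempty finite set with mean `0`, variance `σ ^ 2` and nonnegative third
moment reaches the value `σ`. -/
theorem exists_le_of_moments {Ω : Type*} [Fintype Ω] [Nonempty Ω] (X : Ω → ℝ) {σ : ℝ}
    (h1 : ∑ c, X c = 0) (h2 : ∑ c, X c ^ 2 = Fintype.card Ω * σ ^ 2)
    (h3 : 0 ≤ ∑ c, X c ^ 3) : ∃ c, σ ≤ X c := by
  by_contra! hlt
  have hnn : ∀ c ∈ Finset.univ, 0 ≤ (σ - X c) * (X c + σ) ^ 2 := fun c _ =>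
    mul_nonneg (sub_nonneg.2 (hlt c).le) (sq_nonneg _)
  -- This cubic is nonnegative for X ≤ σ, and the first two moments cancel all but its X³ term.
  -- Equality would force X = -σ everywhere, against mean 0.
  have hsum : ∑ c, (σ - X c) * (X c + σ) ^ 2 = -∑ c, X c ^ 3 := by
    have : ∀ c, (σ - X c) * (X c + σ) ^ 2 = σ ^ 3 + σ ^ 2 * X c - σ * X c ^ 2 - X c ^ 3 :=
      fun c => by ring
    simp only [this, Finset.sum_sub_distrib, Finset.sum_add_distrib, ← Finset.mul_sum, h1, h2,
      Finset.sum_const, Finset.card_univ, nsmul_eq_mul]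
    ring
  have hzero : ∑ c, (σ - X c) * (X c + σ) ^ 2 = 0 :=
    le_antisymm (by linarith) (Finset.sum_nonneg hnn)
  have hX : ∀ c, X c = -σ := fun c => by
    have := (Finset.sum_eq_zero_iff_of_nonneg hnn).1 hzero c (Finset.mem_univ c)
    rcases mul_eq_zero.1 this with h | h
    · exact absurd h (sub_pos.2 (hlt c)).ne'
    · linarith [pow_eq_zero_iff (two_ne_zero) |>.1 h]
  obtain ⟨c⟩ := ‹Nonempty Ω›
  have hσ : 0 < σ := by linarith [hlt c, hX c]
  simp only [hX, Finset.sum_const, Finset.card_univ, nsmul_eq_mul] at h1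
  have : (0 : ℝ) < Fintype.card Ω := by exact_mod_cast Fintype.card_pos_iff.2 ⟨c⟩
  nlinarith

theorem sum_pow_two_eq {Ω A : Type*} [Fintype Ω] [Fintype A] (Y : A → Ω → ℝ)
    (h : ∀ x y, x ≠ y → ∑ c, Y x c * Y y c = 0) :
    ∑ c, (∑ x, Y x c) ^ 2 = ∑ x, ∑ c, Y x c ^ 2 := by
  have : ∀ c, (∑ x, Y x c) ^ 2 = ∑ x, ∑ y, Y x c * Y y c := fun c => by
    rw [pow_two, Finset.sum_mul_sum]
  simp only [this]
  rw [Finset.sum_comm]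
  refine Finset.sum_congr rfl fun x _ => ?_
  rw [Finset.sum_comm, Finset.sum_eq_single x (fun y _ hy => h x y hy.symm) (by simp)]
  exact Finset.sum_congr rfl fun c _ => by ring

/-- A triple of indices that are not all equal contains one that differs from both others, so only
diagonal terms survive. -/
theorem sum_pow_three_eq {Ω A : Type*} [Fintype Ω] [Fintype A] (Y : A → Ω → ℝ)
    (h : ∀ x y z, x ≠ y → x ≠ z → ∑ c, Y x c * (Y y c * Y z c) = 0) :
    ∑ c, (∑ x, Y x c) ^ 3 = ∑ x, ∑ c, Y x c ^ 3 := by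
  have : ∀ c, (∑ x, Y x c) ^ 3 = ∑ x, ∑ y, ∑ z, Y x c * (Y y c * Y z c) := fun c => by
    rw [pow_three, Finset.sum_mul_sum, Finset.sum_mul_sum]
    simp only [Finset.mul_sum]
  simp only [this]
  rw [Finset.sum_comm]
  refine Finset.sum_congr rfl fun x _ => ?_
  rw [Finset.sum_comm, Finset.sum_eq_single x _ (by simp)]
  · rw [Finset.sum_comm, Finset.sum_eq_single x _ (by simp)]
    · exact Finset.sum_congr rfl fun c _ => by ring
    · intro z _ hz
      rw [← h z x x hz hz]
      exact Finset.sum_congr rfl fun c _ => by ring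
  · intro y _ hy
    rw [Finset.sum_comm]
    refine Finset.sum_eq_zero fun z _ => ?_
    by_cases hz : x = z
    · subst hz
      rw [← h y x x hy hy]
      exact Finset.sum_congr rfl fun c _ => by ring
    · exact h x y z hy.symm hz

end Moments

/-! ### Second-moment bound for separating codes -/

section FirstOrder

variable {n t : ℕ} {C : Submodule (ZMod 2) (Fin n → ZMod 2)}

/-- The centered indicator of the event that the matrix `c` agrees with `v` in column `x`. -/
noncomputable def centeredAgreement (v : Matrix (Fin t) (Fin n) (ZMod 2)) (x : Fin n)
    (c : Fin t → C) : ℝ :=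
  (if (fun i => (c i).1 x) = (fun i => v i x) then 1 else 0) - 1 / 2 ^ t

theorem exists_mem_eq_one_eq_zero (h1 : 1 ∈ C)
    (hsep : ∀ x y : Fin n, x ≠ y → ∃ g ∈ C, g x ≠ g y) {x y z : Fin n} (hy : x ≠ y) (hz : x ≠ z) :
    ∃ g ∈ C, g x = 1 ∧ g y = 0 ∧ g z = 0 := by
  have key : ∀ y, x ≠ y → ∃ g ∈ C, g x = 1 ∧ g y = 0 := by
    intro y hy
    obtain ⟨g, hg, hne⟩ := hsep x y hy
    have h01 : ∀ a b : ZMod 2, a ≠ b → a = 1 ∧ b = 0 ∨ 1 + a = 1 ∧ 1 + b = 0 := by decide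
    rcases h01 _ _ hne with h | h
    · exact ⟨g, hg, h⟩
    · exact ⟨1 + g, C.add_mem h1 hg, h⟩
  obtain ⟨g, hg, hgx, hgy⟩ := key y hy
  obtain ⟨k, hk, hkx, hkz⟩ := key z hz
  have h01 : ∀ a : ZMod 2, a = 0 ∨ a = 1 := by decide
  rcases h01 (g z) with hgz | hgz
  · exact ⟨g, hg, hgx, hgy, hgz⟩
  rcases h01 (k y) with hky | hky
  · exact ⟨k, hk, hkx, hky, hkz⟩
  -- Here (g, k) takes the values (1, 1), (0, 1), (1, 0) at `x`, `y`, `z`.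
  refine ⟨1 + (g + k), C.add_mem h1 (C.add_mem hg hk), ?_⟩
  simp only [Pi.add_apply, Pi.one_apply, hgx, hkx, hgy, hky, hgz, hkz]
  decide

/-- Averaging over the translates of `c` by multiples of `g` in each row makes column `x` uniform,
so exactly one of the 2^t translates agrees with `v` there, while `H` does not change. -/
theorem sum_centeredAgreement_mul_eq_zero [Fintype C] (v : Matrix (Fin t) (Fin n) (ZMod 2))
    {x : Fin n} {g : Fin n → ZMod 2} (hg : g ∈ C) (hgx : g x = 1) (H : (Fin t → C) → ℝ)
    (hH : ∀ (b : Fin t → ZMod 2) (c : Fin t → C), H (c + fun i => b i • ⟨g, hg⟩) = H c) :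
    ∑ c : Fin t → C, centeredAgreement v x c * H c = 0 := by
  have hb : ∀ b : Fin t → ZMod 2, ∑ c : Fin t → C, centeredAgreement v x c * H c =
      ∑ c : Fin t → C, centeredAgreement v x (c + fun i => b i • ⟨g, hg⟩) * H c := fun b => by
    rw [← Equiv.sum_comp (Equiv.addRight (fun i => b i • (⟨g, hg⟩ : C)))]
    exact Finset.sum_congr rfl fun c _ => by simp only [Equiv.coe_addRight, hH]
  have hin : ∀ c : Fin t → C,
      ∑ b : Fin t → ZMod 2, centeredAgreement v x (c + fun i => b i • ⟨g, hg⟩) = 0 := fun c => by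
    have hiff : ∀ b : Fin t → ZMod 2,
        ((fun i => ((c + fun i => b i • (⟨g, hg⟩ : C)) i).1 x) = fun i => v i x) ↔
          b = fun i => v i x - (c i).1 x := fun b => by
      simp [funext_iff, hgx, eq_sub_iff_add_eq, add_comm]
    simp only [centeredAgreement, hiff, Finset.sum_sub_distrib, Finset.sum_ite_eq',
      Finset.mem_univ, if_true, Finset.sum_const, Finset.card_univ, Fintype.card_fun,
      ZMod.card, Fintype.card_fin, nsmul_eq_mul]
    push_cast
    field_simp
    ring
  have hsum : (Fintype.card (Fin t → ZMod 2) : ℝ) *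
      ∑ c : Fin t → C, centeredAgreement v x c * H c = 0 := by
    rw [← nsmul_eq_mul, ← Finset.card_univ, ← Finset.sum_const, Finset.sum_congr rfl fun b _ => hb b,
      Finset.sum_comm]
    simp only [← Finset.sum_mul, hin, zero_mul, Finset.sum_const_zero]
  exact (mul_eq_zero.1 hsum).resolve_left (by simp)

theorem centeredAgreement_add_of_eq_zero (v : Matrix (Fin t) (Fin n) (ZMod 2))
    {y : Fin n} {g : Fin n → ZMod 2} (hg : g ∈ C) (hgy : g y = 0) (b : Fin t → ZMod 2)
    (c : Fin t → C) :
    centeredAgreement v y (c + fun i => b i • ⟨g, hg⟩) = centeredAgreement v y c := by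
  simp [centeredAgreement, hgy]

theorem centeredAgreement_sq (v : Matrix (Fin t) (Fin n) (ZMod 2)) (x : Fin n) (c : Fin t → C) :
    centeredAgreement v x c ^ 2 =
      1 / 2 ^ t * (1 - 1 / 2 ^ t) + (1 - 2 * (1 / 2 ^ t)) * centeredAgreement v x c := by
  unfold centeredAgreement
  split_ifs <;> ring

theorem tDist_eq_sub_sum_centeredAgreement (v : Matrix (Fin t) (Fin n) (ZMod 2)) (c : Fin t → C) :
    (tDist (.of fun i => (c i).1) v : ℝ) =
      (1 - 1 / 2 ^ t) * n - ∑ x, centeredAgreement v x c := by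
  classical
  rw [tDist, tWeight_eq_card, Finset.card_filter]
  push_cast
  have : ∀ x : Fin n, (if ∃ i, (.of (fun i => (c i).1) - v : Matrix (Fin t) (Fin n) (ZMod 2)) i x ≠ 0
      then (1 : ℝ) else 0) = (1 - 1 / 2 ^ t) - centeredAgreement v x c := fun x => by
    have hiff : (∃ i, (.of (fun i => (c i).1) - v : Matrix (Fin t) (Fin n) (ZMod 2)) i x ≠ 0) ↔
        ¬ ((fun i => (c i).1 x) = fun i => v i x) := by
      simp [funext_iff, sub_eq_zero]
    unfold centeredAgreement
    simp only [hiff, ite_not]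
    split_ifs <;> ring
  simp only [ne_eq] at this
  simp only [ne_eq, this, Finset.sum_sub_distrib, Finset.sum_const, Finset.card_univ,
    Fintype.card_fin, nsmul_eq_mul]
  ring

/-- A binary code that contains the all-ones word and separates the coordinates satisfies a
second-moment bound on its generalized covering radii. -/
theorem genCoveringRadius_le_of_separating (ht : 1 ≤ t) (h1 : 1 ∈ C)
    (hsep : ∀ x y : Fin n, x ≠ y → ∃ g ∈ C, g x ≠ g y) :
    (genCoveringRadius t C : ℝ) ≤
      (1 - 1 / 2 ^ t) * n - √(n * (1 / 2 ^ t * (1 - 1 / 2 ^ t))) := by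
  classical
  have : Fintype C := Fintype.ofFinite C
  have hp : (1 : ℝ) / 2 ^ t ≤ 1 / 2 := by
    refine one_div_le_one_div_of_le two_pos ?_
    simpa using pow_le_pow_right₀ (one_le_two : (1 : ℝ) ≤ 2) ht
  have hp0 : (0 : ℝ) < 1 / 2 ^ t := by positivity
  refine genCoveringRadius_le_real fun v => ?_
  set p : ℝ := 1 / 2 ^ t with hpdef
  have m3 : ∀ x y z : Fin n, x ≠ y → x ≠ z → ∑ c : Fin t → C, centeredAgreement v x c *
      (centeredAgreement v y c * centeredAgreement v z c) = 0 := fun x y z hy hz => by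
    obtain ⟨g, hg, hgx, hgy, hgz⟩ := exists_mem_eq_one_eq_zero h1 hsep hy hz
    exact sum_centeredAgreement_mul_eq_zero v hg hgx _ fun b c => by
      simp only [centeredAgreement_add_of_eq_zero v hg hgy,
        centeredAgreement_add_of_eq_zero v hg hgz]
  have m2 : ∀ x y : Fin n, x ≠ y → ∑ c : Fin t → C, centeredAgreement v x c *
      centeredAgreement v y c = 0 := fun x y hy => by
    obtain ⟨g, hg, hgx, hgy, -⟩ := exists_mem_eq_one_eq_zero h1 hsep hy hy
    exact sum_centeredAgreement_mul_eq_zero v hg hgx _ fun b c => by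
      simp only [centeredAgreement_add_of_eq_zero v hg hgy]
  have m1 : ∀ x : Fin n, ∑ c : Fin t → C, centeredAgreement v x c = 0 := fun x => by
    simpa using sum_centeredAgreement_mul_eq_zero v h1 (x := x) rfl (fun _ => 1) fun _ _ => rfl
  have s2 : ∀ x : Fin n, ∑ c : Fin t → C, centeredAgreement v x c ^ 2 =
      Fintype.card (Fin t → C) * (p * (1 - p)) := fun x => by
    simp only [centeredAgreement_sq, ← hpdef, Finset.sum_add_distrib, ← Finset.mul_sum, m1,
      Finset.sum_const, Finset.card_univ, nsmul_eq_mul]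
    ring
  -- A centered Bernoulli variable has third moment p(1-p)(1-2p), nonnegative since p ≤ 1/2.
  have s3 : ∀ x : Fin n, 0 ≤ ∑ c : Fin t → C, centeredAgreement v x c ^ 3 := fun x => by
    have : ∀ c : Fin t → C, centeredAgreement v x c ^ 3 =
        p * (1 - p) * centeredAgreement v x c + (1 - 2 * p) * centeredAgreement v x c ^ 2 :=
      fun c => by
        rw [pow_succ, centeredAgreement_sq, ← hpdef]
        ring_nf
        rw [centeredAgreement_sq, ← hpdef]
        ring
    simp only [this, Finset.sum_add_distrib, ← Finset.mul_sum, m1, s2]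
    have : 0 ≤ p * (1 - p) := mul_nonneg hp0.le (by linarith)
    have : 0 ≤ 1 - 2 * p := by linarith
    positivity
  obtain ⟨c, hc⟩ := exists_le_of_moments (σ := √(n * (p * (1 - p))))
    (fun c : Fin t → C => ∑ x, centeredAgreement v x c)
    (by rw [Finset.sum_comm]; exact Finset.sum_eq_zero fun x _ => m1 x)
    (by
      rw [sum_pow_two_eq _ m2, Real.sq_sqrt (mul_nonneg n.cast_nonneg
        (mul_nonneg hp0.le (by linarith)))]
      simp only [s2, Finset.sum_const, Finset.card_univ, Fintype.card_fin, nsmul_eq_mul]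
      ring)
    (by rw [sum_pow_three_eq _ m3]; exact Finset.sum_nonneg fun x _ => s3 x)
  refine ⟨.of fun i => (c i).1, fun i => (c i).2, ?_⟩
  rw [tDist_eq_sub_sum_centeredAgreement]
  linarith

end FirstOrder

/-! ### First-order Reed-Muller codes and the recursion -/

section ReedMuller

theorem reedMuller_succ_succ_of_le {r m : ℕ} (h : m ≤ r) : reedMuller (r + 1) (m + 1) = ⊤ := by
  rw [reedMuller, if_pos h]

theorem reedMuller_succ_succ_of_lt {r m : ℕ} (h : r < m) :
    reedMuller (r + 1) (m + 1) = (uuvCode (reedMuller (r + 1) m) (reedMuller r m)).comap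
      (LinearMap.funLeft (ZMod 2) (ZMod 2) (Fin.cast (two_pow_add_two_pow m))) := by
  rw [reedMuller, if_neg h.not_ge]

theorem append_comp_cast_mem_comap_uuvCode {F : Type*} [Field F] {n N : ℕ} (e : n + n = N)
    {C₁ C₂ : Submodule F (Fin n → F)} {u v : Fin n → F} (hu : u ∈ C₁) (hv : v ∈ C₂) :
    (fun j => Fin.append u (u + v) (Fin.cast e.symm j)) ∈
      (uuvCode C₁ C₂).comap (LinearMap.funLeft F F (Fin.cast e)) :=
  ⟨u, hu, v, hv, by ext j; simp [LinearMap.funLeft]⟩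

theorem one_mem_reedMuller_zero (m : ℕ) : 1 ∈ reedMuller 0 m := by
  cases m with
  | zero => rw [reedMuller]; exact Submodule.mem_top
  | succ m => rw [reedMuller]; exact Submodule.mem_span_singleton_self _

theorem one_mem_reedMuller_one (m : ℕ) : 1 ∈ reedMuller 1 m := by
  induction m with
  | zero => rw [reedMuller]; exact Submodule.mem_top
  | succ m ih =>
    rcases Nat.eq_zero_or_pos m with rfl | hm
    · rw [reedMuller_succ_succ_of_le le_rfl]; exact Submodule.mem_top
    · rw [reedMuller_succ_succ_of_lt hm]
      refine ⟨1, ih, 0, Submodule.zero_mem _, ?_⟩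
      ext j
      refine Fin.addCases (fun i => ?_) (fun i => ?_) j <;>
        simp [LinearMap.funLeft, -Fin.natAdd_eq_addNat]

theorem reedMuller_one_separates (m : ℕ) :
    ∀ x y : Fin (2 ^ m), x ≠ y → ∃ g ∈ reedMuller 1 m, g x ≠ g y := by
  have top : ∀ {n : ℕ} (x y : Fin n), x ≠ y →
      ∃ g ∈ (⊤ : Submodule (ZMod 2) (Fin n → ZMod 2)), g x ≠ g y := fun x y h =>
    ⟨Pi.single x 1, Submodule.mem_top, by simp [h.symm]⟩
  induction m with
  | zero => rw [reedMuller]; exact top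
  | succ m ih =>
    rcases Nat.eq_zero_or_pos m with rfl | hm
    · rw [reedMuller_succ_succ_of_le le_rfl]; exact top
    · rw [reedMuller_succ_succ_of_lt hm]
      -- Words (u, u) separate points within a half; the word (0, 1) separates the two halves.
      have low : ∀ u ∈ reedMuller 1 m, _ := fun u hu => append_comp_cast_mem_comap_uuvCode
        (two_pow_add_two_pow m) hu (reedMuller 0 m).zero_mem
      have high := append_comp_cast_mem_comap_uuvCode
        (two_pow_add_two_pow m) (reedMuller 1 m).zero_mem (one_mem_reedMuller_zero m)
      intro x y
      obtain ⟨x, rfl⟩ := (finCongr (two_pow_add_two_pow m)).surjective x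
      obtain ⟨y, rfl⟩ := (finCongr (two_pow_add_two_pow m)).surjective y
      refine Fin.addCases (fun i => ?_) (fun i => ?_) x <;>
        refine Fin.addCases (fun j => ?_) (fun j => ?_) y <;> intro hxy
      · obtain ⟨u, hu, hne⟩ := ih i j (by rintro rfl; exact hxy rfl)
        exact ⟨_, low u hu, by simpa [-Fin.natAdd_eq_addNat] using hne⟩
      · exact ⟨_, high, by simp [-Fin.natAdd_eq_addNat]⟩
      · exact ⟨_, high, by simp [-Fin.natAdd_eq_addNat]⟩
      · obtain ⟨u, hu, hne⟩ := ih i j (by rintro rfl; exact hxy rfl)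
        exact ⟨_, low u hu, by simpa [-Fin.natAdd_eq_addNat] using hne⟩

theorem rmCoveringRadius_succ_succ_le (t : ℕ) {r m : ℕ} (h : r < m) :
    rmCoveringRadius t (r + 1) (m + 1) ≤
      rmCoveringRadius t (r + 1) m + rmCoveringRadius t r m := by
  unfold rmCoveringRadius
  rw [reedMuller_succ_succ_of_lt h]
  exact genCoveringRadius_uuvCode_le t _ _ _

theorem rmCoveringRadius_one_le {t : ℕ} (ht : 1 ≤ t) (m : ℕ) :
    (rmCoveringRadius t 1 m : ℝ) ≤
      (1 - 1 / 2 ^ t) * 2 ^ m - √(2 ^ t - 1) / 2 ^ t * √2 ^ m := by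
  have h := genCoveringRadius_le_of_separating ht (one_mem_reedMuller_one m)
    (reedMuller_one_separates m)
  have hsqrt : √((2 ^ m : ℕ) * (1 / 2 ^ t * (1 - 1 / 2 ^ t)) : ℝ) =
      √(2 ^ t - 1) / 2 ^ t * √2 ^ m := by
    have h1 : (0 : ℝ) ≤ 2 ^ t - 1 := sub_nonneg.2 (one_le_pow₀ one_le_two)
    rw [Real.sqrt_eq_iff_eq_sq]
    · rw [mul_pow, div_pow, Real.sq_sqrt h1, pow_right_comm √2,
        Real.sq_sqrt zero_le_two]
      push_cast
      field_simp
    · have : (0 : ℝ) ≤ 1 - 1 / 2 ^ t := by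
        rw [sub_nonneg, div_le_one (by positivity)]
        exact one_le_pow₀ one_le_two
      positivity
    · positivity
  rw [hsqrt] at h
  push_cast at h
  exact h

/-- Iterating the `(u, u + v)` recursion from the first-order codes and the full spaces. -/
theorem rmCoveringRadius_succ_le {t : ℕ} (ht : 1 ≤ t) {a : ℝ} (ha : 1 + √2 ≤ a) :
    ∀ m k : ℕ, k + 1 ≤ m → (rmCoveringRadius t (k + 1) m : ℝ) ≤
      (1 - 1 / 2 ^ t) * 2 ^ m - √(2 ^ t - 1) / 2 ^ t *
        ((1 + √2) ^ k * √2 ^ m - a ^ (k + 1) * (1 + 1 / a) ^ m) := by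
  have hs : √2 * √2 = (2 : ℝ) := Real.mul_self_sqrt zero_le_two
  have hs0 : (0 : ℝ) ≤ √2 := Real.sqrt_nonneg 2
  have ha0 : 0 < a := by linarith
  have hc : 0 ≤ √(2 ^ t - 1 : ℝ) / 2 ^ t := by positivity
  set c := √(2 ^ t - 1 : ℝ) / 2 ^ t
  have hb : a * (1 + 1 / a) = a + 1 := by field_simp
  have hb0 : 0 < 1 + 1 / a := by positivity
  set b := 1 + 1 / a
  intro m
  induction m with
  | zero => intro k hk; omega
  | succ m ih =>
    intro k hk
    rcases (Nat.le_of_succ_le_succ hk).eq_or_lt with rfl | hlt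
    -- On the diagonal the correction (a+1)^(k+1) dominates (2+√2)^(k+1), hence the gain; this is
    -- where a ≥ 1+√2 enters.
    · have h0 : rmCoveringRadius t (k + 1) (k + 1) = 0 := by
        rw [rmCoveringRadius, reedMuller_succ_succ_of_le le_rfl, genCoveringRadius_top]
      have h1 : (0 : ℝ) ≤ (1 - 1 / 2 ^ t) * 2 ^ (k + 1) := by
        refine mul_nonneg ?_ (by positivity)
        rw [sub_nonneg, div_le_one (by positivity)]
        exact one_le_pow₀ one_le_two
      have h2 : (1 + √2) ^ k * √2 ^ (k + 1) ≤ a ^ (k + 1) * b ^ (k + 1) := by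
        rw [← mul_pow a b, hb]
        calc (1 + √2) ^ k * √2 ^ (k + 1) ≤ (1 + √2) ^ (k + 1) * √2 ^ (k + 1) := by
              gcongr
              · linarith
              · omega
          _ = (2 + √2) ^ (k + 1) := by rw [← mul_pow]; congr 1; linear_combination hs
          _ ≤ (a + 1) ^ (k + 1) :=
              pow_le_pow_left₀ (by positivity) (by linarith) _
      rw [h0]
      have := mul_nonneg hc (sub_nonneg.2 h2)
      push_cast
      linarith
    · cases k with
      | zero =>
        refine (rmCoveringRadius_one_le ht (m + 1)).trans ?_
        have : 0 ≤ c * (a ^ 1 * b ^ (m + 1)) := by positivity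
        simp only [pow_zero, one_mul, zero_add]
        linarith
      | succ j =>
        have hrec : (rmCoveringRadius t (j + 1 + 1) (m + 1) : ℝ) ≤
            rmCoveringRadius t (j + 1 + 1) m + rmCoveringRadius t (j + 1) m := by
          exact_mod_cast rmCoveringRadius_succ_succ_le t hlt
        have e1 := ih (j + 1) hlt
        have e2 := ih j hlt.le
        refine hrec.trans ((add_le_add e1 e2).trans (le_of_eq ?_))
        -- A product x^j y^m solves the recursion when xy = x + 1, which holds for (1+√2, √2) and
        -- for (a, 1+1/a).
        have i1 : (1 + √2) ^ (j + 1) * √2 ^ (m + 1) =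
            (1 + √2) ^ (j + 1) * √2 ^ m + (1 + √2) ^ j * √2 ^ m := by
          linear_combination (1 + √2) ^ j * √2 ^ m * hs
        have i2 : a ^ (j + 1 + 1) * b ^ (m + 1) =
            a ^ (j + 1 + 1) * b ^ m + a ^ (j + 1) * b ^ m := by
          linear_combination a ^ (j + 1) * b ^ m * hb
        linear_combination c * i1 - c * i2

end ReedMuller

/-! ### Choice of the parameter and asymptotics -/

/-- The expression equals 1 at a = 1+√2, where its logarithmic derivative in `a` has the sign of α -
1/(2+√2), so a slightly larger `a` works. -/
theorem exists_parameter {α : ℝ} (hα0 : 0 < α) (hα1 : α < 1 - 1 / √2) :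
    ∃ a : ℝ, 1 + √2 ≤ a ∧ (a / (1 + √2)) ^ α * ((1 + 1 / a) / √2) < 1 := by
  have hs : √2 * √2 = (2 : ℝ) := Real.mul_self_sqrt zero_le_two
  have hs0 : (0 : ℝ) < √2 := Real.sqrt_pos.2 two_pos
  have hlt : 1 + √2 < 1 / (α * √2) := by
    rw [lt_div_iff₀ (by positivity)]
    have h : α * (2 + √2) < (1 - 1 / √2) * (2 + √2) := by gcongr
    have h' : (1 - 1 / √2) * (2 + √2) = 1 := by
      field_simp
      linear_combination hs
    linear_combination h + h' + α * hs
  -- With d = a/(1+√2) - 1, the bound log x ≤ x - 1 on both factors gives at most d(α - 1/(a√2)),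
  -- negative for a < 1/(α√2).
  obtain ⟨a, ha, ha'⟩ := exists_between hlt
  refine ⟨a, ha.le, ?_⟩
  have ha0 : 0 < a := by linarith
  have hx : 0 < a / (1 + √2) := by positivity
  have hy : 0 < (1 + 1 / a) / √2 := by positivity
  rw [← Real.log_neg_iff (by positivity), Real.log_mul (by positivity) hy.ne', Real.log_rpow hx]
  have l1 : α * Real.log (a / (1 + √2)) ≤ α * (a / (1 + √2) - 1) :=
    mul_le_mul_of_nonneg_left (Real.log_le_sub_one_of_pos hx) hα0.le
  have l2 := Real.log_le_sub_one_of_pos hy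
  have e1 : a / (1 + √2) - 1 = (a - (1 + √2)) / (1 + √2) := by field_simp
  have e2 : (1 + 1 / a) / √2 - 1 = -((a - (1 + √2)) / (1 + √2)) * (1 / (a * √2)) := by
    field_simp
    linear_combination (-a) * hs
  have hd : 0 < (a - (1 + √2)) / (1 + √2) := div_pos (by linarith) (by positivity)
  have hcmp : α < 1 / (a * √2) := by
    rw [lt_div_iff₀ (by positivity)] at ha' ⊢
    linarith
  rw [e1] at l1
  rw [e2] at l2
  nlinarith [mul_pos hd (sub_pos.2 hcmp)]

end GenCov

theorem mainTheorem8 (t : ℕ) (ht : 1 ≤ t) (α : ℝ) (hα0 : 0 < α) (hα1 : α < 1 - 1 / √2) :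
    ∃ ε : ℕ → ℝ, Tendsto ε atTop (𝓝 0) ∧
      ∀ m r : ℕ, 1 ≤ m → (r : ℝ) = α * m →
        (GenCov.rmCoveringRadius t r m : ℝ) ≤
          (1 - 1 / 2 ^ t) * 2 ^ m
            - √(2 ^ t - 1) / (2 ^ t * (2 + √2))
              * (2 : ℝ) ^ ((m : ℝ) * (1 / 2 + α * Real.logb 2 (1 + √2))) * (1 + ε m) := by
  obtain ⟨a, ha, hδ⟩ := GenCov.exists_parameter hα0 hα1
  have hs : √2 * √2 = (2 : ℝ) := Real.mul_self_sqrt zero_le_two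
  have hs0 : (0 : ℝ) < √2 := Real.sqrt_pos.2 two_pos
  have ha0 : 0 < a := by linarith
  have hx : 0 < a / (1 + √2) := by positivity
  set δ : ℝ := (a / (1 + √2)) ^ α * ((1 + 1 / a) / √2) with hδdef
  have hδ0 : 0 ≤ δ := by positivity
  -- For r = αm, δ^m is the ratio of a^r (1+1/a)^m to (1+√2)^r √2^m; the factor 2+√2 cancels the
  -- denominator of the main term.
  refine ⟨fun m => -(2 + √2) * δ ^ m, ?_, fun m r hm hr => ?_⟩
  · simpa using (tendsto_pow_atTop_nhds_zero_of_lt_one hδ0 hδ).const_mul (-(2 + √2))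
  have hm0 : (0 : ℝ) < m := by exact_mod_cast hm
  have hr0 : 0 < r := by
    have : (0 : ℝ) < r := by rw [hr]; positivity
    exact_mod_cast this
  have hα : α ≤ 1 := by
    have : (0 : ℝ) < 1 / √2 := by positivity
    linarith
  have hrm : r ≤ m := by
    have : (r : ℝ) ≤ m := by rw [hr]; exact mul_le_of_le_one_left hm0.le hα
    exact_mod_cast this
  obtain ⟨k, rfl⟩ : ∃ k, r = k + 1 := ⟨r - 1, by omega⟩
  have hmain := GenCov.rmCoveringRadius_succ_le ht ha m k hrm
  have hpow : (2 : ℝ) ^ ((m : ℝ) * (1 / 2 + α * Real.logb 2 (1 + √2))) =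
      (1 + √2) ^ (k + 1) * √2 ^ m := by
    rw [show (m : ℝ) * (1 / 2 + α * Real.logb 2 (1 + √2)) =
        Real.logb 2 (1 + √2) * ((k + 1 : ℕ) : ℝ) + 1 / 2 * (m : ℝ) by rw [hr]; ring,
      Real.rpow_add two_pos, Real.rpow_mul zero_le_two, Real.rpow_mul zero_le_two,
      Real.rpow_logb two_pos (by norm_num) (by positivity), ← Real.sqrt_eq_rpow,
      Real.rpow_natCast, Real.rpow_natCast]
  have hδm : δ ^ m * ((1 + √2) ^ (k + 1) * √2 ^ m) = a ^ (k + 1) * (1 + 1 / a) ^ m := by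
    rw [hδdef, mul_pow, ← Real.rpow_mul_natCast hx.le, ← hr, Real.rpow_natCast, div_pow, div_pow]
    field_simp
  rw [hpow]
  refine hmain.trans ?_
  rw [← hδm]
  -- Since 2+√2 = √2(1+√2), a factor √2 is given away here.
  have hle : (1 + √2) ^ (k + 1) * √2 ^ m / (2 + √2) ≤ (1 + √2) ^ k * √2 ^ m := by
    rw [div_le_iff₀ (by positivity), pow_succ]
    have : 0 ≤ (1 + √2) ^ k * √2 ^ m := by positivity
    nlinarith
  have hc : 0 ≤ √(2 ^ t - 1 : ℝ) / 2 ^ t := by positivity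
  have heq : √(2 ^ t - 1 : ℝ) / (2 ^ t * (2 + √2)) * ((1 + √2) ^ (k + 1) * √2 ^ m) *
      (1 + -(2 + √2) * δ ^ m) = √(2 ^ t - 1 : ℝ) / 2 ^ t *
        ((1 + √2) ^ (k + 1) * √2 ^ m / (2 + √2) - δ ^ m * ((1 + √2) ^ (k + 1) * √2 ^ m)) := by
    field_simp
    ring
  rw [heq]
  have := mul_le_mul_of_nonneg_left hle hc
  linarith
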